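/- Fix a first-order alphabet with an infinite set of variables and finitely many constant, function and predicate symbols. A normal logic program \(P\) is a finite set of rules \(p \gets p_1,\dots,p_m,\sim p_{m+1},\dots,\sim p_k\) with \(k\ge m\ge 0\), where \(p\) and all \(p_i\) are atoms; a rule is identified with its head \(p\), its positive body \(\{p_1,\dots,p_m\}\) and its negative body \(\{p_{m+1},\dots,p_k\}\). Let \(\mathrm{HB}_P\) be the set of ground (variable-free) atoms and \(\mathrm{gr}(P)\) the set of all ground instances of rules of \(P\). The program \(P\) is called uni-rule if every atom of \(\mathrm{HB}_P\) is the head of at most one rule of \(\mathrm{gr}(P)\). A three-valued interpretation is a map \(I\colon \mathrm{HB}_P\to\{\mathbf f,\mathbf u,\mathbf t\}\). Interpretations are ordered pointwise by the truth order \(\mathbf f<\mathbf u<\mathbf t\). The reduct \(P^I\) is obtained from \(\mathrm{gr}(P)\) by deleting each rule having a literal \(\sim b\) in its body with \(I(b)=\mathbf t\), deleting from the remaining rules each literal \(\sim b\) with \(I(b)=\mathbf f\), and replacing each remaining \(\sim b\) by a special atom that always has the value \(\mathbf u\). An interpretation \(J\) is a model of \(P^I\) if, for every rule of \(P^I\),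 the minimum of the values under \(J\) of its body atoms (\(\mathbf t\) for an empty body) is at most the value of its head. The interpretation \(I\) is a stable partial model of \(P\) if \(I\) is the least model of \(P^I\). It is an L-stable model of \(P\) if it is a stable partial model of \(P\) and there is no stable partial model \(J\) of \(P\) with \(\{a : J(a)=\mathbf u\}\subsetneq\{a : I(a)=\mathbf u\}\). Theorem. Every uni-rule normal logic program has at least one L-stable model. -/

import Mathlib

universe u v w

/-- The three-valued domain: false, undefined, true. -/
inductive TruthValue : Type
  | ff : TruthValue
  | uu : TruthValue
  | tt : TruthValue

namespace TruthValue

/-- Position of a truth value in the truth order. -/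
def rank : TruthValue → ℕ
  | ff => 0
  | uu => 1
  | tt => 2

theorem rank_injective : Function.Injective rank := by
  intro a b h
  cases a <;> cases b <;> simp_all [rank]

/-- The truth order `ff < uu < tt`. -/
noncomputable instance : LinearOrder TruthValue := LinearOrder.lift' rank rank_injective

theorem le_iff_rank_le (a b : TruthValue) : a ≤ b ↔ rank a ≤ rank b := Iff.rfl

noncomputable instance : BoundedOrder TruthValue where
  top := tt
  le_top a := by
    change rank a ≤ rank tt
    cases a <;> simp [rank]
  bot := ff
  bot_le a := by
    change rank ff ≤ rank a
    cases a <;> simp [rank]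

end TruthValue

namespace NLP

/-- A rule `head ← p₁, …, pₘ, ∼pₘ₊₁, …, ∼pₖ` over a set `A` of atoms, with finite positive body
`{p₁, …, pₘ}` and finite negative body `{pₘ₊₁, …, pₖ}`. -/
@[ext] structure Rule (A : Type u) where
  head : A
  pos : Finset A
  neg : Finset A

open Classical in
/-- Replace every atom of a rule by its image under `f`. -/
noncomputable def Rule.map {A : Type u} {B : Type v} (f : A → B) (r : Rule A) : Rule B where
  head := f r.head
  pos := r.pos.image f
  neg := r.neg.image f

/-- Atoms `p(t₁, …, tₖ)` of the language `L` with variables in `V`. Constants are function symbols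
of arity `0`. -/
@[ext] structure Atom (L : FirstOrder.Language.{u, v}) (V : Type w) where
  arity : ℕ
  pred : L.Relations arity
  args : Fin arity → L.Term V

/-- Application of a substitution to an atom. -/
def Atom.subst {L : FirstOrder.Language.{u, v}} {V : Type*} {W : Type*} (σ : V → L.Term W)
    (a : Atom L V) : Atom L W where
  arity := a.arity
  pred := a.pred
  args i := (a.args i).subst σ

/-- A normal logic program: a finite set of rules over the atoms of `L` with variables in `V`. -/
abbrev Program (L : FirstOrder.Language.{u, v}) (V : Type w) := Finset (Rule (Atom L V))

/-- The Herbrand base: atoms without variables. -/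
abbrev GroundAtom (L : FirstOrder.Language.{u, v}) := Atom L Empty

/-- A ground atom, regarded as an atom with variables in `V`. -/
def GroundAtom.lift {L : FirstOrder.Language.{u, v}} (V : Type w) (a : GroundAtom L) : Atom L V :=
  Atom.subst (fun e : Empty => e.elim) a

/-- The ground instantiation of `P`: all variable-free rules obtained from rules of `P` by a
substitution. (The substitution takes values in all terms, so that a rule without variables is an
instance of itself even if `L` has no constants.) -/
def Program.ground {L : FirstOrder.Language.{u, v}} {V : Type w} (P : Program L V) :
    Set (Rule (GroundAtom L)) :=
  {g | ∃ r ∈ P, ∃ σ : V → L.Term V, r.map (Atom.subst σ) = g.map (GroundAtom.lift V)}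

/-- Every ground atom is the head of at most one rule of the ground instantiation. -/
def Program.IsUniRule {L : FirstOrder.Language.{u, v}} {V : Type w} (P : Program L V) : Prop :=
  ∀ a : GroundAtom L, {r ∈ P.ground | r.head = a}.Subsingleton

/-- Three-valued interpretations of a set of atoms; they carry the pointwise truth order. -/
abbrev Interp (A : Type u) := A → TruthValue

/-- A rule of a reduct. Its body is a finite set of atoms of `A` (written `some a`), possibly
together with the special atom `𝐮` (written `none`). -/
structure ReductRule (A : Type u) where
  head : A
  body : Finset (Option A)

/-- Value of an atom of `A` or of the special atom `𝐮`, which is always undefined. -/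
def Interp.ext {A : Type u} (J : Interp A) : Option A → TruthValue
  | some a => J a
  | none => TruthValue.uu

open Classical in
/-- Delete from the body of `r` the literals `∼b` with `I b` false, and replace those with `I b`
undefined by `𝐮`. (Only applied when no `I b` is true.) -/
noncomputable def Rule.reduct {A : Type u} (r : Rule A) (I : Interp A) : ReductRule A where
  head := r.head
  body := r.pos.image some ∪ (r.neg.filter fun b => I b = TruthValue.uu).image fun _ => none

/-- The reduct of a set of ground rules with respect to `I`. -/
def reduct {A : Type u} (R : Set (Rule A)) (I : Interp A) : Set (ReductRule A) :=
  {ρ | ∃ r ∈ R, (∀ b ∈ r.neg, I b ≠ TruthValue.tt) ∧ ρ = r.reduct I}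

/-- `J` is a three-valued model of a set of reduct rules: the value of the body (the minimum of the
values of its atoms, true if it is empty) is at most the value of the head. -/
def IsModel {A : Type u} (R : Set (ReductRule A)) (J : Interp A) : Prop :=
  ∀ ρ ∈ R, ρ.body.inf J.ext ≤ J ρ.head

/-- The set of undefined atoms. -/
def Interp.undef {A : Type u} (I : Interp A) : Set A := {a | I a = TruthValue.uu}

/-- `I` is the least three-valued model, in the truth order, of the reduct of `P` by `I`. -/
def Program.IsStablePartialModel {L : FirstOrder.Language.{u, v}} {V : Type w} (P : Program L V)
    (I : Interp (GroundAtom L)) : Prop :=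
  IsLeast {J : Interp (GroundAtom L) | IsModel (reduct P.ground I) J} I

/-- A stable partial model whose set of undefined atoms is minimal under inclusion. -/
def Program.IsLStableModel {L : FirstOrder.Language.{u, v}} {V : Type w} (P : Program L V)
    (I : Interp (GroundAtom L)) : Prop :=
  P.IsStablePartialModel I ∧
    ¬ ∃ J : Interp (GroundAtom L), P.IsStablePartialModel J ∧ J.undef ⊂ I.undef

end NLP

namespace TruthValue

/-! An interpretation amounts to a pair `T ⊆ U` of its true and its non-false atoms. With `Γ` the
antitone Gelfond–Lifschitz operator `gammaOp`, stability becomes `T = Γ U` and `U = Γ T`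
(`isLeast_isModel_reduct_iff`); the least fixed point of `Γ ∘ Γ` provides a solution. For a uni-rule
program, an atom has essentially one possible derivation, and this is finite. So membership in `Γ X`
depends on finitely many atoms of `X` (`exists_finset_mem_gammaOp_iff`), and the stable partial
models form a closed subset of a compact product of finite discrete spaces. Compactness bounds
chains of undefined sets from below, and Zorn's lemma gives a minimal one. -/

theorem tt_eq_top : tt = ⊤ := rfl

theorem ff_eq_bot : ff = ⊥ := rfl

theorem le_iff_tt_ff (v w : TruthValue) : v ≤ w ↔ (v = tt → w = tt) ∧ (v ≠ ff → w ≠ ff) := by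
  rw [le_iff_rank_le]
  cases v <;> cases w <;> simp [rank]

instance : Finite TruthValue :=
  Set.finite_univ_iff.1 ((Set.toFinite {ff, uu, tt}).subset fun v _ => by cases v <;> simp)

end TruthValue

namespace NLP

open TruthValue

/-! ### Stable partial models as alternating fixed points -/

section Operator

variable {A : Type*} (R : Set (Rule A))

/-- The atoms derivable from the rules whose negative body is disjoint from `X`. -/
inductive Derivable (X : Set A) : A → Prop
  | intro (r : Rule A) (hr : r ∈ R) (hneg : ∀ b ∈ r.neg, b ∉ X)
      (hpos : ∀ p ∈ r.pos, Derivable X p) : Derivable X r.head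

/-- The Gelfond–Lifschitz operator. -/
def gammaOp (X : Set A) : Set A := {a | Derivable R X a}

theorem gammaOp_antitone : Antitone (gammaOp R) := by
  intro X Y h a ha
  induction ha with
  | intro r hr hneg _ ih => exact .intro r hr (fun b hb hX => hneg b hb (h hX)) ih

/-- The set of true atoms. -/
def Interp.trueSet (I : Interp A) : Set A := {a | I a = tt}

/-- The set of atoms that are not false. -/
def Interp.possibleSet (I : Interp A) : Set A := {a | I a ≠ ff}

theorem Interp.trueSet_subset_possibleSet (I : Interp A) : I.trueSet ⊆ I.possibleSet := by
  intro a ha h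
  rw [Interp.trueSet, Set.mem_ofPred_eq, h] at ha
  cases ha

theorem Interp.le_iff_subset (I J : Interp A) :
    I ≤ J ↔ I.trueSet ⊆ J.trueSet ∧ I.possibleSet ⊆ J.possibleSet := by
  constructor
  · intro h
    exact ⟨fun a => ((le_iff_tt_ff _ _).1 (h a)).1, fun a => ((le_iff_tt_ff _ _).1 (h a)).2⟩
  · intro h a
    exact (le_iff_tt_ff _ _).2 ⟨@h.1 a, @h.2 a⟩

open Classical in
/-- The interpretation with given sets of true and of not false atoms. -/
noncomputable def Interp.ofSets (T U : Set A) : Interp A :=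
  fun a => if a ∈ T then tt else if a ∈ U then uu else ff

theorem Interp.trueSet_ofSets (T U : Set A) : (Interp.ofSets T U).trueSet = T := by
  ext a
  by_cases hT : a ∈ T <;> by_cases hU : a ∈ U <;> simp [ofSets, trueSet, hT, hU]

theorem Interp.possibleSet_ofSets {T U : Set A} (h : T ⊆ U) :
    (Interp.ofSets T U).possibleSet = U := by
  ext a
  by_cases hT : a ∈ T
  · simp [ofSets, possibleSet, hT, h hT]
  · by_cases hU : a ∈ U <;> simp [ofSets, possibleSet, hT, hU]

theorem Rule.reduct_inf_eq_tt_iff (r : Rule A) {I : Interp A} (hI : ∀ b ∈ r.neg, I b ≠ tt)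
    (J : Interp A) : (r.reduct I).body.inf J.ext = tt ↔
      (∀ b ∈ r.neg, b ∉ I.possibleSet) ∧ ∀ p ∈ r.pos, p ∈ J.trueSet := by
  rw [tt_eq_top, Finset.inf_eq_top_iff]
  constructor
  · intro h
    refine ⟨fun b hb hp => ?_, fun p hp => h (some p) (by simp [Rule.reduct, hp])⟩
    have hu : I b = uu := by
      have h1 := hI b hb
      have h2 : I b ≠ ff := hp
      cases hv : I b <;> simp_all
    have := h none (by simpa [Rule.reduct] using ⟨b, hb, hu⟩)
    cases this
  · rintro ⟨h1, h2⟩ o ho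
    cases o with
    | none =>
      simp [Rule.reduct] at ho
      obtain ⟨b, hb, hu⟩ := ho
      exact absurd (by simp [Interp.possibleSet, hu]) (h1 b hb)
    | some p =>
      simp [Rule.reduct] at ho
      exact h2 p ho

theorem Rule.reduct_inf_ne_ff_iff (r : Rule A) (I J : Interp A) :
    (r.reduct I).body.inf J.ext ≠ ff ↔ ∀ p ∈ r.pos, p ∈ J.possibleSet := by
  rw [ff_eq_bot, ← bot_lt_iff_ne_bot,
    Finset.lt_inf_iff (by rw [bot_lt_iff_ne_bot]; intro h; cases h)]
  constructor
  · intro h p hp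
    exact bot_lt_iff_ne_bot.1 (h (some p) (by simp [Rule.reduct, hp]))
  · intro h o ho
    cases o with
    | none => rw [bot_lt_iff_ne_bot]; intro h; cases h
    | some p =>
      simp [Rule.reduct] at ho
      exact bot_lt_iff_ne_bot.2 (h p ho)

/-- The two thresholds of the truth order decouple. An occurrence of `𝐮` keeps a body from being
true, so truth needs every negated atom false in `I`; it never makes a body false, so for
non-falsity the rule only has to survive the reduct. -/
theorem isModel_reduct_iff (I J : Interp A) : IsModel (reduct R I) J ↔ ∀ r ∈ R,
    ((∀ b ∈ r.neg, b ∉ I.possibleSet) → (∀ p ∈ r.pos, p ∈ J.trueSet) → r.head ∈ J.trueSet) ∧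
    ((∀ b ∈ r.neg, b ∉ I.trueSet) → (∀ p ∈ r.pos, p ∈ J.possibleSet) →
      r.head ∈ J.possibleSet) := by
  constructor
  · intro h r hr
    have key (hI : ∀ b ∈ r.neg, I b ≠ tt) := (le_iff_tt_ff _ _).1 (h _ ⟨r, hr, hI, rfl⟩)
    constructor
    · intro h1 h2
      have hI : ∀ b ∈ r.neg, I b ≠ tt := fun b hb ht => h1 b hb (I.trueSet_subset_possibleSet ht)
      exact (key hI).1 ((r.reduct_inf_eq_tt_iff hI J).2 ⟨h1, h2⟩)
    · intro h1 h2
      exact (key h1).2 ((r.reduct_inf_ne_ff_iff I J).2 h2)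
  · rintro h _ ⟨r, hr, hI, rfl⟩
    rw [le_iff_tt_ff, r.reduct_inf_eq_tt_iff hI, r.reduct_inf_ne_ff_iff]
    exact ⟨fun h1 => (h r hr).1 h1.1 h1.2, (h r hr).2 hI⟩

theorem isLeast_isModel_reduct (I : Interp A) : IsLeast {J : Interp A | IsModel (reduct R I) J}
    (Interp.ofSets (gammaOp R I.possibleSet) (gammaOp R I.trueSet)) := by
  have hsub := gammaOp_antitone R I.trueSet_subset_possibleSet
  constructor
  · rw [Set.mem_ofPred_eq, isModel_reduct_iff, Interp.trueSet_ofSets,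
      Interp.possibleSet_ofSets hsub]
    exact fun r hr => ⟨.intro r hr, .intro r hr⟩
  · intro J hJ
    rw [Set.mem_ofPred_eq, isModel_reduct_iff] at hJ
    rw [Interp.le_iff_subset, Interp.trueSet_ofSets, Interp.possibleSet_ofSets hsub]
    constructor
    · intro a ha
      induction ha with
      | intro r hr hneg _ ih => exact (hJ r hr).1 hneg ih
    · intro a ha
      induction ha with
      | intro r hr hneg _ ih => exact (hJ r hr).2 hneg ih

theorem isLeast_isModel_reduct_iff (I : Interp A) :
    IsLeast {J : Interp A | IsModel (reduct R I) J} I ↔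
      I.trueSet = gammaOp R I.possibleSet ∧ I.possibleSet = gammaOp R I.trueSet := by
  have hsub := gammaOp_antitone R I.trueSet_subset_possibleSet
  have hl := isLeast_isModel_reduct R I
  constructor
  · intro h
    have e := h.unique hl
    exact ⟨(congrArg Interp.trueSet e).trans (Interp.trueSet_ofSets _ _),
      (congrArg Interp.possibleSet e).trans (Interp.possibleSet_ofSets hsub)⟩
  · rintro ⟨h1, h2⟩
    have e : I = Interp.ofSets (gammaOp R I.possibleSet) (gammaOp R I.trueSet) := by
      apply le_antisymm <;>
        rw [Interp.le_iff_subset, Interp.trueSet_ofSets, Interp.possibleSet_ofSets hsub]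
      · exact ⟨h1.le, h2.le⟩
      · exact ⟨h1.ge, h2.ge⟩
    rw [← e] at hl
    exact hl

/-- The well-founded model is a stable partial model. -/
theorem exists_isLeast_isModel_reduct :
    ∃ I : Interp A, IsLeast {J : Interp A | IsModel (reduct R I) J} I := by
  have hanti := gammaOp_antitone R
  let Γ₂ : Set A →o Set A := ⟨fun X => gammaOp R (gammaOp R X), fun X Y h => hanti (hanti h)⟩
  have hfix : gammaOp R (gammaOp R Γ₂.lfp) = Γ₂.lfp := Γ₂.map_lfp
  -- The image of a fixed point of `Γ₂` under `gammaOp R` is again a fixed point of `Γ₂`.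
  have hsub : Γ₂.lfp ⊆ gammaOp R Γ₂.lfp :=
    Γ₂.lfp_le_fixed (congrArg (gammaOp R) hfix)
  refine ⟨Interp.ofSets Γ₂.lfp (gammaOp R Γ₂.lfp), ?_⟩
  rw [isLeast_isModel_reduct_iff, Interp.trueSet_ofSets, Interp.possibleSet_ofSets hsub]
  exact ⟨hfix.symm, rfl⟩

open Classical in
/-- If every atom heads at most one rule, whether an atom is in `gammaOp R X` depends only on the
membership in `X` of finitely many atoms. -/
theorem exists_finset_mem_gammaOp_iff (hR : ∀ a, {r ∈ R | r.head = a}.Subsingleton) (a : A) :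
    ∃ N : Finset A, ∀ X Y : Set A, (∀ b ∈ N, b ∈ X ↔ b ∈ Y) →
      (a ∈ gammaOp R X ↔ a ∈ gammaOp R Y) := by
  by_cases h : ∃ X, Derivable R X a
  · obtain ⟨X₀, h⟩ := h
    -- One derivation, from any `X₀`, suffices: each atom in it heads a single rule, so for every
    -- `X` a derivation must use the same rules.
    induction h with
    | intro r hr _ _ ih =>
      choose! N hN using ih
      have key (X : Set A) : r.head ∈ gammaOp R X ↔
          (∀ b ∈ r.neg, b ∉ X) ∧ ∀ p ∈ r.pos, p ∈ gammaOp R X := by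
        constructor
        · intro h
          generalize hh : r.head = a at h
          obtain ⟨s, hs, hneg, hpos⟩ := h
          obtain rfl : r = s := hR _ ⟨hr, hh⟩ ⟨hs, rfl⟩
          exact ⟨hneg, hpos⟩
        · exact fun h => .intro r hr h.1 h.2
      refine ⟨r.neg ∪ r.pos.biUnion N, fun X Y hXY => ?_⟩
      rw [key, key]
      refine and_congr (forall₂_congr fun b hb => not_congr (hXY b ?_))
        (forall₂_congr fun p hp => hN p hp X Y fun b hb => hXY b ?_)
      · exact Finset.mem_union_left _ hb
      · exact Finset.mem_union_right _ (Finset.mem_biUnion.2 ⟨p, hp, hb⟩)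
  · exact ⟨∅, fun X Y _ => iff_of_false (fun h' => h ⟨X, h'⟩) fun h' => h ⟨Y, h'⟩⟩

end Operator

/-! ### Compactness and minimal undefined sets -/

section Compactness

variable {A : Type*}

/-- The discrete topology on the truth values. -/
local instance : TopologicalSpace TruthValue := ⊥

local instance : DiscreteTopology TruthValue := ⟨rfl⟩

/-- Such a set is the preimage of its image under restriction to `N`, a continuous map into a
finite, hence discrete, product. -/
theorem isClosed_setOf_of_finset {p : Interp A → Prop} (N : Finset A)
    (h : ∀ I J : Interp A, (∀ b ∈ N, I b = J b) → (p I ↔ p J)) : IsClosed {I | p I} := by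
  have hc : Continuous fun (I : Interp A) (b : N) => I b := by fun_prop
  convert (isClosed_discrete ((fun (I : Interp A) (b : N) => I b) '' {I | p I})).preimage hc
  ext I
  constructor
  · exact fun hI => ⟨I, hI, rfl⟩
  · rintro ⟨J, hJ, e⟩
    exact (h J I fun b hb => congrFun e ⟨b, hb⟩).1 hJ

open Classical in
theorem isClosed_setOf_isLeast_isModel_reduct (R : Set (Rule A))
    (hR : ∀ a, {r ∈ R | r.head = a}.Subsingleton) :
    IsClosed {I : Interp A | IsLeast {J : Interp A | IsModel (reduct R I) J} I} := by
  simp_rw [isLeast_isModel_reduct_iff, Set.ext_iff, ← forall_and, Set.ofPred_forall]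
  refine isClosed_iInter fun a => ?_
  obtain ⟨N, hN⟩ := exists_finset_mem_gammaOp_iff R hR a
  refine isClosed_setOf_of_finset (insert a N) fun I J h => ?_
  have ha : I a = J a := h a (Finset.mem_insert_self a N)
  have hb (b) (hb : b ∈ N) : I b = J b := h b (Finset.mem_insert_of_mem hb)
  rw [hN I.possibleSet J.possibleSet fun b h => by simp [Interp.possibleSet, hb b h],
    hN I.trueSet J.trueSet fun b h => by simp [Interp.trueSet, hb b h]]
  simp [Interp.trueSet, Interp.possibleSet, ha]

/-- A nonempty closed set of interpretations has an element with minimal set of undefined atoms. -/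
theorem exists_minimal_undef_of_isClosed {S : Set (Interp A)} (hS : IsClosed S)
    (hne : S.Nonempty) : ∃ I ∈ S, ¬ ∃ J ∈ S, J.undef ⊂ I.undef := by
  obtain ⟨m, ⟨⟨I, hI, rfl⟩, hmin⟩⟩ := zorn_superset (Interp.undef '' S) (by
    intro c hc hchain
    rcases c.eq_empty_or_nonempty with rfl | hcne
    · obtain ⟨I, hI⟩ := hne
      exact ⟨I.undef, ⟨I, hI, rfl⟩, by simp⟩
    · have : Nonempty c := hcne.to_subtype
      -- Requiring the undefined atoms to lie within `s`, rather than to equal `s`, makes these sets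
      -- both closed and nested along the chain.
      let t : c → Set (Interp A) := fun s => S ∩ {I | ∀ a, a ∉ s.1 → I a ≠ uu}
      have hcl (s : c) : IsClosed (t s) := by
        refine hS.inter ?_
        simp_rw [Set.ofPred_forall]
        refine isClosed_iInter fun a => isClosed_iInter fun _ => ?_
        exact isClosed_setOf_of_finset {a} fun I J h => by rw [h a (Finset.mem_singleton_self a)]
      obtain ⟨I, hI⟩ := IsCompact.nonempty_iInter_of_directed_nonempty_isCompact_isClosed t
        (by
          intro s s'
          rcases hchain.total s.2 s'.2 with h | h
          · exact ⟨s, subset_rfl, fun I hI => ⟨hI.1, fun a ha => hI.2 a fun h' => ha (h h')⟩⟩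
          · exact ⟨s', fun I hI => ⟨hI.1, fun a ha => hI.2 a fun h' => ha (h h')⟩, subset_rfl⟩)
        (by
          intro s
          obtain ⟨I, hI, e⟩ := hc s.2
          exact ⟨I, hI, fun a ha h => ha (e ▸ h)⟩)
        (fun s => (hcl s).isCompact) hcl
      rw [Set.mem_iInter] at hI
      refine ⟨I.undef, ⟨I, (hI (Classical.arbitrary c)).1, rfl⟩, fun s hs a ha => ?_⟩
      by_contra h
      exact (hI ⟨s, hs⟩).2 a h ha)
  exact ⟨I, hI, fun ⟨J, hJ, hlt⟩ => hlt.2 (hmin ⟨J, hJ, rfl⟩ hlt.1)⟩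

end Compactness

end NLP

/-- Every uni-rule normal logic program over a finite alphabet has an L-stable model. -/
theorem mainTheorem11 (L : FirstOrder.Language.{u, v}) [Finite L.Symbols]
    (V : Type w) [Infinite V] (P : NLP.Program L V) (hP : P.IsUniRule) :
    ∃ I : NLP.Interp (NLP.GroundAtom L), P.IsLStableModel I := by
  obtain ⟨I, hI, hmin⟩ := NLP.exists_minimal_undef_of_isClosed
    (NLP.isClosed_setOf_isLeast_isModel_reduct P.ground hP)
    (NLP.exists_isLeast_isModel_reduct P.ground)
  exact ⟨I, hI, hmin⟩
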